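/- Let $\mathbf{k}$ be a commutative ring. Work in $\mathbf{k}[[x_1,x_2,x_3,\ldots]]$ and let $\mathrm{QSym}$ be the $\mathbf{k}$-algebra of quasisymmetric functions: the power series of bounded degree in which, for every composition (finite sequence of positive integers) $(\alpha_1,\ldots,\alpha_\ell)$, all monomials $x_{i_1}^{\alpha_1}\cdots x_{i_\ell}^{\alpha_\ell}$ with $i_1<\cdots<i_\ell$ have equal coefficients. Let $M_\alpha=\sum_{i_1<\cdots<i_\ell}x_{i_1}^{\alpha_1}\cdots x_{i_\ell}^{\alpha_\ell}$ be the monomial basis of $\mathrm{QSym}$, and let $\varepsilon(g)$ denote the constant term of $g\in\mathrm{QSym}$. For a composition $\alpha=(\alpha_1,\ldots,\alpha_\ell)$ put $|\alpha|=\alpha_1+\cdots+\alpha_\ell$, $D(\alpha)=\{\alpha_1,\alpha_1+\alpha_2,\ldots,\alpha_1+\cdots+\alpha_{\ell-1}\}$ and $\operatorname{rev}\alpha=(\alpha_\ell,\ldots,\alpha_1)$. Let $\omega(\alpha)$ be the unique composition of $n=|\alpha|$ with $D(\omega(\alpha))=\{1,\ldots,n-1\}\setminus D(\operatorname{rev}\alpha)$,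 and let $$F_\alpha=\sum_{\substack{i_1\le i_2\le\cdots\le i_n;\\ i_j<i_{j+1}\text{ if }j\in D(\alpha)}}x_{i_1}x_{i_2}\cdots x_{i_n}$$ be the fundamental quasisymmetric function. Let $\mathrm{NSym}$ be the algebra of noncommutative symmetric functions (the free associative $\mathbf{k}$-algebra on $H_1,H_2,\ldots$), with the bilinear pairing $(\cdot,\cdot):\mathrm{NSym}\times\mathrm{QSym}\to\mathbf{k}$ for which the basis $(H_{\alpha_1}\cdots H_{\alpha_\ell})_\alpha$ is dual to $(M_\alpha)_\alpha$. Let $(R_\alpha)_\alpha$ be the ribbon basis of $\mathrm{NSym}$, i.e. the basis dual to $(F_\alpha)_\alpha$. For $g\in\mathrm{NSym}$ let $g^\perp:\mathrm{QSym}\to\mathrm{QSym}$ be the linear map adjoint to left multiplication by $g$: $(b,g^\perp c)=(gb,c)$ for all $b\in\mathrm{NSym}$, $c\in\mathrm{QSym}$. Let $\prec$ and ⋗ be the $\mathbf{k}$-bilinear continuous operations on $\mathbf{k}[[x_1,x_2,\ldots]]$ (with the product topology) given on monomials $\mathfrak m,\mathfrak n$ as follows: $\mathfrak m\prec\mathfrak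 n=\mathfrak m\mathfrak n$ if $\min(\operatorname{Supp}\mathfrak m)<\min(\operatorname{Supp}\mathfrak n)$ and $\mathfrak m\prec\mathfrak n=0$ otherwise; and $\mathfrak m$ ⋗ $\mathfrak n=\mathfrak m\mathfrak n$ if $\max(\operatorname{Supp}\mathfrak m)\le\min(\operatorname{Supp}\mathfrak n)$ and $\mathfrak m$ ⋗ $\mathfrak n=0$ otherwise. Here $\operatorname{Supp}$ is the set of indices of the variables that occur, $\max\varnothing=0$, and $\min\varnothing=\infty$, which is greater than every integer but not than itself (so $1\prec 1=0$). Let $a,f\in\mathrm{QSym}$. Then all but finitely many compositions $\alpha$ satisfy $R_{\omega(\alpha)}^\perp f=0$, and if $\varepsilon(a)\varepsilon(f)=0$, then $$\sum_{\alpha}(-1)^{|\alpha|}\,(F_\alpha\text{ ⋗ }a)\,R_{\omega(\alpha)}^\perp f=a\prec f,$$ where the sum ranges over all compositions $\alpha$. For arbitrary $a,f\in\mathrm{QSym}$, the left-hand side equals $a\prec f+\varepsilon(a)\varepsilon(f)\cdot 1$. -/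

import Mathlib

noncomputable section

namespace QuasiSymm

/-- Compositions: finite sequences of positive integers. -/
abbrev Comp := List ℕ+

/-- The size `|α|`: the sum of the entries of `α`. -/
def size (α : Comp) : ℕ := (α.map (fun a : ℕ+ => (a : ℕ))).sum

/-- `D(α) = {α₁, α₁ + α₂, …, α₁ + ⋯ + α_{ℓ-1}}`. -/
def partialSums (α : Comp) : Finset ℕ :=
  (Finset.Ioo 0 α.length).image (fun i => size (α.take i))

@[simp] theorem size_nil : size [] = 0 := rfl

@[simp] theorem size_cons (a : ℕ+) (α : Comp) : size (a :: α) = a + size α := by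
  simp [size]

theorem size_append (α β : Comp) : size (α ++ β) = size α + size β := by
  simp [size]

theorem size_eq_zero {α : Comp} : size α = 0 ↔ α = [] := by
  cases α <;> simp

theorem size_take_strictMonoOn (α : Comp) :
    StrictMonoOn (fun i => size (α.take i)) (Set.Iic α.length) := by
  intro i _ j hj hij
  have hj' : j ≤ α.length := hj
  have h : α.take j = α.take i ++ (α.drop i).take (j - i) := by
    rw [← List.take_add]; congr 1; omega
  have h2 : size ((α.drop i).take (j - i)) ≠ 0 := by
    rw [Ne, size_eq_zero]
    intro h3
    have := congrArg List.length h3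
    simp at this
    omega
  simp only [h, size_append]
  omega

theorem partialSums_subset (α : Comp) : partialSums α ⊆ Finset.Ioo 0 (size α) := by
  intro x hx
  simp only [partialSums, Finset.mem_image, Finset.mem_Ioo] at hx ⊢
  obtain ⟨i, ⟨h0, h1⟩, rfl⟩ := hx
  have a := size_take_strictMonoOn α (show (0:ℕ) ∈ Set.Iic α.length by simp) (show i ∈ _ from h1.le) h0
  have b := size_take_strictMonoOn α (show i ∈ Set.Iic α.length from h1.le)
    (show α.length ∈ Set.Iic α.length by simp) h1
  simp at a b
  omega

@[simp] theorem partialSums_nil : partialSums [] = ∅ := by simp [partialSums]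

@[simp] theorem partialSums_singleton (a : ℕ+) : partialSums [a] = ∅ := by
  simp [partialSums, Finset.image_eq_empty]
  ext; simp; omega

theorem partialSums_cons_cons (a b : ℕ+) (α : Comp) :
    partialSums (a :: b :: α) =
      insert (a : ℕ) ((partialSums (b :: α)).image (fun x => (a : ℕ) + x)) := by
  ext x
  simp only [partialSums, Finset.mem_image, Finset.mem_insert, Finset.mem_Ioo, List.length_cons]
  constructor
  · rintro ⟨i, ⟨h0, h1⟩, rfl⟩
    obtain ⟨i, rfl⟩ : ∃ k, i = k + 1 := ⟨i - 1, by omega⟩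
    rcases Nat.eq_zero_or_pos i with rfl | hi
    · left; simp
    · right
      exact ⟨_, ⟨i, ⟨hi, by omega⟩, rfl⟩, by simp⟩
  · rintro (rfl | ⟨_, ⟨i, ⟨h0, h1⟩, rfl⟩, rfl⟩)
    · exact ⟨1, by simp, by simp⟩
    · exact ⟨i + 1, ⟨by omega, by omega⟩, by simp⟩

/-- A composition is determined by its size and its set of partial sums. -/
theorem comp_ext {α β : Comp} (hs : size α = size β) (hD : partialSums α = partialSums β) :
    α = β := by
  induction α generalizing β with
  | nil => symm; simpa [size_eq_zero] using hs.symm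
  | cons a α ih =>
    cases β with
    | nil => simp at hs
    | cons b β =>
      rcases α with _ | ⟨a', α⟩ <;> rcases β with _ | ⟨b', β⟩
      · simp at hs
        rw [hs]
      · rw [partialSums_singleton, partialSums_cons_cons] at hD
        exact absurd hD.symm (Finset.insert_ne_empty _ _)
      · rw [partialSums_singleton, partialSums_cons_cons] at hD
        exact absurd hD (Finset.insert_ne_empty _ _)
      · have hle : ∀ (c c' : ℕ+) (γ : Comp), ∀ x ∈ partialSums (c :: c' :: γ), (c : ℕ) ≤ x := by
          intro c c' γ x hx
          rw [partialSums_cons_cons] at hx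
          simp only [Finset.mem_insert, Finset.mem_image] at hx
          rcases hx with rfl | ⟨y, _, rfl⟩ <;> omega
        have hmem : ∀ (c c' : ℕ+) (γ : Comp), (c : ℕ) ∈ partialSums (c :: c' :: γ) := by
          intro c c' γ
          rw [partialSums_cons_cons]
          exact Finset.mem_insert_self _ _
        have hab : (a : ℕ) = b := by
          apply le_antisymm
          · exact hle _ _ _ _ (hD ▸ hmem b b' β)
          · exact hle _ _ _ _ (hD ▸ hmem a a' α)
        have hab' : a = b := PNat.coe_injective hab
        subst hab'
        congr 1
        apply ih
        · simpa using hs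
        · rw [partialSums_cons_cons, partialSums_cons_cons] at hD
          have hpos : ∀ γ : Comp, (a : ℕ) ∉ (partialSums γ).image (fun x => (a : ℕ) + x) := by
            intro γ h
            rw [Finset.mem_image] at h
            obtain ⟨x, hx, h⟩ := h
            have := Finset.mem_Ioo.1 (partialSums_subset γ hx)
            omega
          have := congrArg (fun s => s.erase (a : ℕ)) hD
          simp only [Finset.erase_insert (hpos _)] at this
          exact Finset.image_injective (add_right_injective (a : ℕ)) this

theorem exists_comp (n : ℕ) (S : Finset ℕ) (hS : S ⊆ Finset.Ioo 0 n) :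
    ∃ α : Comp, size α = n ∧ partialSums α = S := by
  induction n using Nat.strong_induction_on generalizing S with
  | _ n ih =>
    rcases Nat.eq_zero_or_pos n with rfl | hn
    · exact ⟨[], rfl, by simpa using (by simpa using hS : S = ∅).symm⟩
    rcases S.eq_empty_or_nonempty with rfl | hne
    · exact ⟨[n.toPNat hn], by rw [size_cons]; rfl, partialSums_singleton _⟩
    set m := S.min' hne with hm
    have hmS : m ∈ S := S.min'_mem hne
    have hm0 := Finset.mem_Ioo.1 (hS hmS)
    obtain ⟨α, h1, h2⟩ := ih (n - m) (by omega) ((S.erase m).image (fun x => x - m)) (by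
      intro x hx
      simp only [Finset.mem_image, Finset.mem_erase] at hx
      obtain ⟨y, ⟨hy, hyS⟩, rfl⟩ := hx
      have := S.min'_le y hyS
      have := Finset.mem_Ioo.1 (hS hyS)
      rw [Finset.mem_Ioo]
      omega)
    rcases α with _ | ⟨b, α⟩
    · simp at h1; omega
    refine ⟨m.toPNat hm0.1 :: b :: α, ?_, ?_⟩
    · rw [size_cons, h1, Nat.toPNat, PNat.mk_coe]; omega
    · rw [partialSums_cons_cons, h2, Finset.image_image]
      conv_rhs => rw [← Finset.insert_erase hmS]
      simp only [Nat.toPNat, PNat.mk_coe]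
      congr 1
      conv_rhs => rw [← Finset.image_id (s := S.erase m)]
      apply Finset.image_congr
      intro y hy
      have hy' := Finset.mem_erase.1 hy
      have := S.min'_le y hy'.2
      simp
      omega

theorem existsUnique_comp (n : ℕ) (S : Finset ℕ) (hS : S ⊆ Finset.Ioo 0 n) :
    ∃! α : Comp, size α = n ∧ partialSums α = S := by
  obtain ⟨α, h⟩ := exists_comp n S hS
  exact ⟨α, h, fun β hβ => comp_ext (hβ.1.trans h.1.symm) (hβ.2.trans h.2.symm)⟩

/-- `ω(α)`: the unique composition `β` of `n = |α|` with
`D(β) = {1, …, n - 1} \ D(rev α)`; uniqueness is `existsUnique_comp`. -/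
def omegaComp (α : Comp) : Comp :=
  (exists_comp (size α) (Finset.Ioo 0 (size α) \ partialSums α.reverse) Finset.sdiff_subset).choose

theorem omegaComp_spec (α : Comp) : size (omegaComp α) = size α ∧
    partialSums (omegaComp α) = Finset.Ioo 0 (size α) \ partialSums α.reverse :=
  (exists_comp (size α) (Finset.Ioo 0 (size α) \ partialSums α.reverse)
    Finset.sdiff_subset).choose_spec

/-!
The variables `x₁, x₂, x₃, …` are indexed by `ℕ`, the index `i : ℕ` standing for `x_{i+1}`.
A monomial is its exponent vector `ℕ →₀ ℕ`.
-/

/-- The monomial `x_{i₁}^{α₁} x_{i₂}^{α₂} ⋯ x_{i_ℓ}^{α_ℓ}`. -/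
def monoAt (α : Comp) (i : Fin α.length → ℕ) : ℕ →₀ ℕ :=
  ∑ t, Finsupp.single (i t) (α.get t : ℕ)

/-- Pack-equivalence of monomials. -/
def PackEquiv (m n : ℕ →₀ ℕ) : Prop :=
  ∃ (α : Comp) (i j : Fin α.length → ℕ), StrictMono i ∧ StrictMono j ∧
    m = monoAt α i ∧ n = monoAt α j

/-- Bounded-degree power series. -/
def BoundedDegree {k : Type*} [CommRing k] (P : MvPowerSeries ℕ k) : Prop :=
  ∃ N : ℕ, ∀ m : ℕ →₀ ℕ, N < m.degree → MvPowerSeries.coeff m P = 0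

/-- Quasisymmetric power series: pack-equivalent monomials have equal coefficients. -/
def IsQuasisymmetric {k : Type*} [CommRing k] (P : MvPowerSeries ℕ k) : Prop :=
  ∀ m n : ℕ →₀ ℕ, PackEquiv m n → MvPowerSeries.coeff m P = MvPowerSeries.coeff n P

/-- The `k`-module `QSym` of quasisymmetric functions: the quasisymmetric power series of bounded
degree. -/
def QSym (k : Type*) [CommRing k] : Submodule k (MvPowerSeries ℕ k) where
  carrier := {P | BoundedDegree P ∧ IsQuasisymmetric P}
  zero_mem' := ⟨⟨0, fun _ _ => by simp⟩, fun _ _ _ => by simp⟩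
  add_mem' := by
    rintro P Q ⟨⟨N, hN⟩, hP⟩ ⟨⟨N', hN'⟩, hQ⟩
    refine ⟨⟨max N N', fun m hm => ?_⟩, fun m n h => ?_⟩
    · rw [map_add, hN m (lt_of_le_of_lt (le_max_left _ _) hm),
        hN' m (lt_of_le_of_lt (le_max_right _ _) hm), add_zero]
    · rw [map_add, map_add, hP m n h, hQ m n h]
  smul_mem' := by
    rintro c P ⟨⟨N, hN⟩, hP⟩
    refine ⟨⟨N, fun m hm => ?_⟩, fun m n h => ?_⟩
    · rw [map_smul, hN m hm, smul_zero]
    · rw [map_smul, map_smul, hP m n h]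

theorem monoAt_apply {α : Comp} {i : Fin α.length → ℕ} (hi : StrictMono i) (t : Fin α.length) :
    monoAt α i (i t) = α.get t := by
  rw [monoAt, Finsupp.finsetSum_apply, Finset.sum_eq_single t]
  · simp
  · intro b _ hb
    exact Finsupp.single_eq_of_ne (fun h => hb (hi.injective h).symm)
  · simp

theorem monoAt_support {α : Comp} {i : Fin α.length → ℕ} (hi : StrictMono i) :
    (monoAt α i).support = Finset.univ.image i := by
  ext x
  rw [Finsupp.mem_support_iff, Finset.mem_image]
  constructor
  · intro h
    by_contra h2
    apply h
    rw [monoAt, Finsupp.finsetSum_apply]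
    refine Finset.sum_eq_zero fun t _ => ?_
    exact Finsupp.single_eq_of_ne (fun h => h2 ⟨t, Finset.mem_univ _, h.symm⟩)
  · rintro ⟨t, _, rfl⟩
    rw [monoAt_apply hi]
    exact PNat.ne_zero _

theorem degree_monoAt (α : Comp) (i : Fin α.length → ℕ) : (monoAt α i).degree = size α := by
  rw [monoAt, map_sum]
  simp only [Finsupp.degree_single, size]
  exact Fin.sum_univ_fun_getElem α (fun a : ℕ+ => (a : ℕ))

/-- The exponents of a monomial that are positive, listed by increasing index of the variable. -/
def pack (m : ℕ →₀ ℕ) : Comp := (m.support.sort).map (fun i => (m i).toPNat')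

theorem pack_monoAt {α : Comp} {i : Fin α.length → ℕ} (hi : StrictMono i) :
    pack (monoAt α i) = α := by
  have h : (monoAt α i).support.sort = List.ofFn i := by
    rw [monoAt_support hi]
    have : (Finset.univ.image i) = (List.ofFn i).toFinset := by
      ext; simp
    rw [this]
    exact (List.toFinset_sort (· ≤ ·) (List.nodup_ofFn.2 hi.injective)).2
      (List.pairwise_ofFn.2 fun _ _ h => (hi h).le)
  rw [pack, h]
  apply List.ext_get
  · simp
  · intro n h1 h2
    have := monoAt_apply hi ⟨n, h2⟩
    simp [this]

theorem exists_monoAt (m : ℕ →₀ ℕ) : ∃ i : Fin (pack m).length → ℕ, StrictMono i ∧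
    m = monoAt (pack m) i := by
  have hl : (pack m).length = m.support.card := by simp [pack]
  let i : Fin (pack m).length → ℕ := fun t => m.support.orderEmbOfFin hl.symm t
  have hi : StrictMono i := (m.support.orderEmbOfFin hl.symm).strictMono
  have hsup : m.support = Finset.univ.image i := by
    rw [← Finset.image_orderEmbOfFin_univ m.support hl.symm]
  refine ⟨i, hi, ?_⟩
  ext x
  by_cases hx : x ∈ m.support
  · rw [hsup, Finset.mem_image] at hx
    obtain ⟨t, _, rfl⟩ := hx
    rw [monoAt_apply hi]
    have : m (i t) ≠ 0 := by
      rw [← Finsupp.mem_support_iff, hsup]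
      exact Finset.mem_image_of_mem _ (Finset.mem_univ _)
    have h2 : (pack m).get t = (m (i t)).toPNat' := by
      simp only [i]
      rw [Finset.orderEmbOfFin_apply]
      exact List.getElem_map _
    rw [h2, Nat.toPNat'_coe, if_pos (Nat.pos_of_ne_zero this)]
  · have h2 := hx
    rw [hsup, ← monoAt_support hi] at h2
    rw [Finsupp.notMem_support_iff.1 hx, Finsupp.notMem_support_iff.1 h2]

theorem PackEquiv.pack_eq {m n : ℕ →₀ ℕ} (h : PackEquiv m n) : pack m = pack n := by
  obtain ⟨α, i, j, hi, hj, rfl, rfl⟩ := h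
  rw [pack_monoAt hi, pack_monoAt hj]

/-- The `k`-algebra `NSym` of noncommutative symmetric functions: the free associative algebra on
`H₁, H₂, H₃, …`. Its basis is indexed by the words in the positive integers, i.e. by compositions,
and words are multiplied by concatenation. -/
abbrev NSym (k : Type*) [CommRing k] := MonoidAlgebra k (FreeMonoid ℕ+)

/-- `H_α = H_{α₁} H_{α₂} ⋯ H_{α_ℓ}`. -/
def H (k : Type*) [CommRing k] (α : Comp) : NSym k :=
  MonoidAlgebra.of k (FreeMonoid ℕ+) (FreeMonoid.ofList α)

/-- The coefficient of the monomial quasisymmetric function `M_α` in the expansion of an element of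
`QSym` in the monomial basis, i.e. the coefficient of `x₁^{α₁} x₂^{α₂} ⋯ x_ℓ^{α_ℓ}`. -/
def coeffM (k : Type*) [CommRing k] (α : Comp) : QSym k →ₗ[k] k :=
  (MvPowerSeries.coeff (monoAt α (fun t => (t : ℕ)))).comp (QSym k).subtype

/-- The pairing `(·,·)` between `NSym` and `QSym`: the bilinear form for which the basis `(H_α)` of
`NSym` is dual to the basis `(M_α)` of `QSym`. As `H_α H_β = H_{[α,β]}` and
`Δ(M_γ) = ∑_{[α,β] = γ} M_α ⊗ M_β`, the product of `NSym` is dual to the coproduct of `QSym`. -/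
def pairing (k : Type*) [CommRing k] : NSym k →ₗ[k] QSym k →ₗ[k] k :=
  (MonoidAlgebra.basis (FreeMonoid ℕ+) k).constr k (fun w => coeffM k w.toList)

section
variable {k : Type*} [CommRing k]

theorem pairing_H (α : Comp) (f : QSym k) : pairing k (H k α) f =
    MvPowerSeries.coeff (monoAt α (fun t => (t : ℕ))) (f : MvPowerSeries ℕ k) := by
  have : H k α = MonoidAlgebra.basis (FreeMonoid ℕ+) k (FreeMonoid.ofList α) := by
    simp [H]
  rw [pairing, this, Module.Basis.constr_basis]
  rfl

theorem H_mul_H (α β : Comp) : H k α * H k β = H k (α ++ β) := by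
  rw [H, H, H, ← map_mul]
  rfl

theorem pairing_H_eq_coeff (f : QSym k) {α : Comp} {i : Fin α.length → ℕ} (hi : StrictMono i) :
    pairing k (H k α) f = MvPowerSeries.coeff (monoAt α i) (f : MvPowerSeries ℕ k) := by
  rw [pairing_H]
  exact f.2.2 _ _ ⟨α, _, i, fun _ _ h => h, hi, rfl, rfl⟩

/-- The pairing is nondegenerate on the side of `QSym`. -/
theorem qsym_ext {f g : QSym k} (h : ∀ a, pairing k a f = pairing k a g) : f = g := by
  apply Subtype.ext
  ext m
  obtain ⟨i, hi, hm⟩ := exists_monoAt m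
  rw [hm, ← pairing_H_eq_coeff f hi, ← pairing_H_eq_coeff g hi, h]

theorem nsym_linear_ext {V : Type*} [AddCommGroup V] [Module k V] {S T : NSym k →ₗ[k] V}
    (h : ∀ α, S (H k α) = T (H k α)) : S = T := by
  apply (MonoidAlgebra.basis (FreeMonoid ℕ+) k).ext
  intro w
  have := h w.toList
  simpa [H] using this

/-- An element of `QSym` may be prescribed by its pairings with the basis `H`, if all but those of
bounded size are zero. -/
theorem exists_qsym (c : Comp → k) (N : ℕ) (hc : ∀ α, N < size α → c α = 0) :
    ∃ f : QSym k, ∀ α, pairing k (H k α) f = c α := by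
  refine ⟨⟨fun m => c (pack m), ⟨N, fun m hm => hc _ ?_⟩, fun m n h => ?_⟩, fun α => ?_⟩
  · obtain ⟨i, hi, h⟩ := exists_monoAt m
    rwa [h, degree_monoAt] at hm
  · exact congrArg c h.pack_eq
  · rw [pairing_H]
    exact congrArg c (pack_monoAt (fun _ _ h => h))

theorem pairing_mul_eq_zero (g : NSym k) (f : QSym k) :
    ∃ N : ℕ, ∀ α, N < size α → pairing k (g * H k α) f = 0 := by
  obtain ⟨N, hN⟩ := f.2.1
  refine ⟨N, fun α hα => ?_⟩
  have : (pairing k).flip f ∘ₗ LinearMap.mulRight k (H k α) = 0 := by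
    apply nsym_linear_ext
    intro β
    simp only [LinearMap.comp_apply, LinearMap.mulRight_apply, LinearMap.flip_apply, H_mul_H,
      pairing_H, LinearMap.zero_apply]
    apply hN
    rw [degree_monoAt, size_append]
    omega
  exact LinearMap.congr_fun this g

/-- Left multiplication by `g` on `NSym` has exactly one adjoint on `QSym`. -/
theorem existsUnique_adjoint (g : NSym k) :
    ∃! T : QSym k →ₗ[k] QSym k, ∀ a c, pairing k a (T c) = pairing k (g * a) c := by
  have h (c : QSym k) : ∃ d : QSym k, ∀ a, pairing k a d = pairing k (g * a) c := by
    obtain ⟨N, hN⟩ := pairing_mul_eq_zero g c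
    obtain ⟨d, hd⟩ := exists_qsym (fun α => pairing k (g * H k α) c) N hN
    refine ⟨d, fun a => ?_⟩
    have : (pairing k).flip d = (pairing k).flip c ∘ₗ LinearMap.mulLeft k g := by
      apply nsym_linear_ext
      intro β
      simpa using hd β
    exact LinearMap.congr_fun this a
  choose T hT using h
  refine ⟨⟨⟨T, fun c d => qsym_ext fun a => ?_⟩, fun r c => qsym_ext fun a => ?_⟩,
    fun a c => hT c a, fun U hU => LinearMap.ext fun c => qsym_ext fun a => ?_⟩
  · simp [hT]
  · simp [hT]
  · rw [hU]
    exact (hT c a).symm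

/-- `g^⊥ : QSym → QSym`: the unique `k`-linear map adjoint to left multiplication by `g` on
`NSym`. -/
def perp (g : NSym k) : QSym k →ₗ[k] QSym k := (existsUnique_adjoint g).choose

theorem pairing_perp (g a : NSym k) (c : QSym k) :
    pairing k a (perp g c) = pairing k (g * a) c :=
  (existsUnique_adjoint g).choose_spec.1 a c


/-- The condition on an index tuple `(i₁, …, i_n)`, `n = |α|`, in the sum that defines `F_α`:
`i₁ ≤ i₂ ≤ ⋯ ≤ i_n` and `i_j < i_{j+1}` if `j ∈ D(α)`. (Positions are counted from `0` in `Fin n`,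
so the `j`-th and the `(j+1)`-st positions are `s, t` with `s + 1 = t = j`.) -/
def Admissible (α : Comp) (i : Fin (size α) → ℕ) : Prop :=
  ∀ s t : Fin (size α), (s : ℕ) + 1 = t →
    i s ≤ i t ∧ ((t : ℕ) ∈ partialSums α → i s < i t)

/-- `F_α = ∑ x_{i₁} x_{i₂} ⋯ x_{i_n}` over all admissible tuples: the coefficient of a monomial is
the number of admissible tuples that give this monomial (this number is at most `1`). -/
def fundamentalSeries (k : Type*) [CommRing k] (α : Comp) : MvPowerSeries ℕ k := fun m =>
  (Nat.card {i : Fin (size α) → ℕ // Admissible α i ∧ ∑ t, Finsupp.single (i t) 1 = m} : k)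

theorem monotone_of_step {n : ℕ} {v : Fin n → ℕ}
    (h : ∀ s t : Fin n, (s : ℕ) + 1 = t → v s ≤ v t) : Monotone v := by
  cases n with
  | zero => exact fun s => s.elim0
  | succ n =>
    rw [Fin.monotone_iff_le_succ]
    intro i
    exact h _ _ (by simp)

theorem eq_of_content_eq {n : ℕ} {v w : Fin n → ℕ} (hv : Monotone v) (hw : Monotone w)
    (h : ∑ t, Finsupp.single (v t) 1 = ∑ t, Finsupp.single (w t) 1) : v = w := by
  have h2 := congrArg Finsupp.toMultiset h
  have h3 : ∀ u : Fin n → ℕ, Finsupp.toMultiset (∑ t, Finsupp.single (u t) 1) =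
      (List.ofFn u : Multiset ℕ) := by
    intro u
    rw [map_sum, ← Fin.univ_val_map]
    simp only [Finsupp.toMultiset_single, one_smul]
    rw [← Multiset.sum_map_singleton (Multiset.map u _), Multiset.map_map]
    rfl
  rw [h3, h3, Multiset.coe_eq_coe] at h2
  apply List.ofFn_injective
  exact h2.eq_of_pairwise' (r := (· ≤ ·)) (List.pairwise_ofFn.2 fun _ _ h => hv h.le)
    (List.pairwise_ofFn.2 fun _ _ h => hw h.le)

/-- The (zero-based) number of the block of `γ` in which the position `t` lies. -/
def block (γ : Comp) (t : ℕ) : ℕ := ((partialSums γ).filter (· ≤ t)).card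

theorem block_eq {γ : Comp} {j t : ℕ} (hj : j < γ.length) (h1 : size (γ.take j) ≤ t)
    (h2 : t < size (γ.take (j + 1))) : block γ t = j := by
  have hmono := size_take_strictMonoOn γ
  have : (partialSums γ).filter (· ≤ t) =
      (Finset.Ioc 0 j).image (fun i => size (γ.take i)) := by
    ext x
    simp only [partialSums, Finset.mem_filter, Finset.mem_image, Finset.mem_Ioo, Finset.mem_Ioc]
    constructor
    · rintro ⟨⟨i, ⟨h0, hi⟩, rfl⟩, hx⟩
      refine ⟨i, ⟨h0, ?_⟩, rfl⟩
      by_contra hij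
      have := (hmono.le_iff_le (show j + 1 ∈ Set.Iic γ.length from hj)
        (show i ∈ Set.Iic γ.length from hi.le)).2 (by omega)
      omega
    · rintro ⟨i, ⟨h0, hi⟩, rfl⟩
      refine ⟨⟨i, ⟨h0, by omega⟩, rfl⟩, le_trans ?_ h1⟩
      exact (hmono.le_iff_le (show i ∈ Set.Iic γ.length from (by omega : i ≤ γ.length))
        (show j ∈ Set.Iic γ.length from hj.le)).2 hi
  rw [block, this, Finset.card_image_of_injOn]
  · simp
  · intro a ha b hb hab
    simp only [Finset.coe_Ioc, Set.mem_Ioc] at ha hb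
    exact hmono.injOn (show a ≤ γ.length by omega) (show b ≤ γ.length by omega) hab

theorem block_lt {γ : Comp} {t : ℕ} (ht : t < size γ) : block γ t < γ.length := by
  have h0 : 0 < γ.length := by
    rcases γ with _ | ⟨a, γ⟩
    · simp at ht
    · simp
  calc block γ t ≤ (partialSums γ).card := Finset.card_filter_le _ _
    _ ≤ (Finset.Ioo 0 γ.length).card := Finset.card_image_le
    _ < γ.length := by simp; omega

theorem block_succ (γ : Comp) (t : ℕ) :
    block γ (t + 1) = block γ t + if t + 1 ∈ partialSums γ then 1 else 0 := by
  rw [block, block]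
  split_ifs with h
  · have : (partialSums γ).filter (· ≤ t + 1) =
        insert (t + 1) ((partialSums γ).filter (· ≤ t)) := by
      ext x
      simp only [Finset.mem_filter, Finset.mem_insert]
      constructor
      · rintro ⟨h1, h2⟩
        by_cases hx : x = t + 1
        · exact Or.inl hx
        · exact Or.inr ⟨h1, by omega⟩
      · rintro (rfl | ⟨h1, h2⟩)
        · exact ⟨h, le_rfl⟩
        · exact ⟨h1, by omega⟩
    rw [this, Finset.card_insert_of_notMem (by simp)]
  · rw [add_zero]
    congr 1
    ext x
    simp only [Finset.mem_filter]
    constructor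
    · rintro ⟨h1, h2⟩
      refine ⟨h1, ?_⟩
      by_contra h3
      exact h ((by omega : x = t + 1) ▸ h1)
    · rintro ⟨h1, h2⟩
      exact ⟨h1, by omega⟩

theorem sum_block {V : Type*} [AddCommMonoid V] (γ : Comp) (f : ℕ → V) :
    ∑ t ∈ Finset.range (size γ), f (block γ t) =
      ∑ j : Fin γ.length, (γ.get j : ℕ) • f j := by
  have h : ∀ J (hJ : J ≤ γ.length), ∑ t ∈ Finset.range (size (γ.take J)), f (block γ t) =
      ∑ j : Fin J, (γ.get (Fin.castLE hJ j) : ℕ) • f j := by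
    intro J
    induction J with
    | zero => simp
    | succ J ih =>
      intro hJ
      have hs : size (γ.take (J + 1)) = size (γ.take J) + γ[J] := by
        rw [List.take_succ_eq_append_getElem hJ, size_append, size_cons, size_nil, add_zero]
      rw [Fin.sum_univ_castSucc, hs, Finset.sum_range_add, ih (by omega)]
      congr 1
      rw [Finset.sum_congr rfl (g := fun _ => f J)]
      · simp
      · intro x hx
        have := Finset.mem_range.1 hx
        rw [block_eq hJ (by omega) (by omega)]
  have := h γ.length le_rfl
  rw [List.take_length] at this
  exact this

theorem coeff_fundamentalSeries (β γ : Comp) {i : Fin γ.length → ℕ} (hi : StrictMono i) :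
    MvPowerSeries.coeff (monoAt γ i) (fundamentalSeries k β) =
      if size γ = size β ∧ partialSums β ⊆ partialSums γ then 1 else 0 := by
  classical
  change (Nat.card {v : Fin (size β) → ℕ // Admissible β v ∧
    ∑ t, Finsupp.single (v t) 1 = monoAt γ i} : k) = _
  by_cases hs : size γ = size β
  swap
  · rw [if_neg (fun h => hs h.1)]
    have : IsEmpty {v : Fin (size β) → ℕ // Admissible β v ∧
        ∑ t, Finsupp.single (v t) 1 = monoAt γ i} := by
      refine ⟨fun ⟨v, _, h⟩ => hs ?_⟩
      have := congrArg Finsupp.degree h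
      rw [degree_monoAt] at this
      simpa using this.symm
    simp
  let i' : ℕ → ℕ := fun j => if h : j < γ.length then i ⟨j, h⟩ else 0
  let w : Fin (size β) → ℕ := fun t => i' (block γ t)
  have hblk : ∀ t : Fin (size β), block γ t < γ.length := fun t => block_lt (by have := t.2; omega)
  have hw : ∀ t, w t = i ⟨block γ t, hblk t⟩ := fun t => dif_pos (hblk t)
  have hstep : ∀ s t : Fin (size β), (s : ℕ) + 1 = t →
      w s ≤ w t ∧ (w s < w t ↔ (t : ℕ) ∈ partialSums γ) := by
    intro s t hst
    have := block_succ γ s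
    rw [hst] at this
    rw [hw, hw, hi.le_iff_le, hi.lt_iff_lt, Fin.mk_le_mk, Fin.mk_lt_mk, this]
    split_ifs with h <;> simp [h]
  have hcont : ∑ t, Finsupp.single (w t) 1 = monoAt γ i := by
    have h1 := sum_block γ (fun j => Finsupp.single (i' j) (1 : ℕ))
    rw [hs, Finset.sum_range] at h1
    rw [monoAt]
    refine h1.trans (Finset.sum_congr rfl fun j _ => ?_)
    simp [i']
  have hmono : Monotone w := monotone_of_step fun s t h => (hstep s t h).1
  by_cases hD : partialSums β ⊆ partialSums γ
  · rw [if_pos ⟨hs, hD⟩]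
    have : Nat.card {v : Fin (size β) → ℕ // Admissible β v ∧
        ∑ t, Finsupp.single (v t) 1 = monoAt γ i} = 1 := by
      rw [Nat.card_eq_one_iff_unique]
      refine ⟨⟨fun ⟨v, h1, h2⟩ ⟨v', h1', h2'⟩ => Subtype.ext ?_⟩, ⟨⟨w, fun s t h => ?_, hcont⟩⟩⟩
      · exact eq_of_content_eq (monotone_of_step fun s t h => (h1 s t h).1)
          (monotone_of_step fun s t h => (h1' s t h).1) (h2.trans h2'.symm)
      · exact ⟨(hstep s t h).1, fun ht => (hstep s t h).2.2 (hD ht)⟩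
    rw [this, Nat.cast_one]
  · rw [if_neg (fun h => hD h.2)]
    have : IsEmpty {v : Fin (size β) → ℕ // Admissible β v ∧
        ∑ t, Finsupp.single (v t) 1 = monoAt γ i} := by
      refine ⟨fun ⟨v, h1, h2⟩ => hD fun x hx => ?_⟩
      have hvw : v = w := eq_of_content_eq (monotone_of_step fun s t h => (h1 s t h).1) hmono
        (h2.trans hcont.symm)
      have hx' := Finset.mem_Ioo.1 (partialSums_subset β hx)
      have h3 := (h1 ⟨x - 1, by omega⟩ ⟨x, hx'.2⟩ (by simp; omega)).2 hx
      rw [hvw] at h3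
      exact (hstep _ _ (by simp; omega)).2.1 h3
    simp

/-- The fundamental quasisymmetric function `F_α`, as an element of `QSym`. -/
def F (k : Type*) [CommRing k] (α : Comp) : QSym k :=
  ⟨fundamentalSeries k α, ⟨size α, fun m hm => by
    obtain ⟨i, hi, h⟩ := exists_monoAt m
    rw [h, degree_monoAt] at hm
    rw [h, coeff_fundamentalSeries _ _ hi, if_neg (fun h => by omega)]⟩, by
    rintro _ _ ⟨γ, i, j, hi, hj, rfl, rfl⟩
    rw [coeff_fundamentalSeries _ _ hi, coeff_fundamentalSeries _ _ hj]⟩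

theorem pairing_H_F (α β : Comp) : pairing k (H k α) (F k β) =
    if size α = size β ∧ partialSums β ⊆ partialSums α then 1 else 0 := by
  rw [pairing_H]
  exact coeff_fundamentalSeries β α fun _ _ h => h

/-- The composition of `n` whose set of partial sums is `S ∩ {1, …, n - 1}`. -/
def ofPartialSums (n : ℕ) (S : Finset ℕ) : Comp :=
  (exists_comp n (S ∩ Finset.Ioo 0 n) Finset.inter_subset_right).choose

theorem size_ofPartialSums (n : ℕ) (S : Finset ℕ) : size (ofPartialSums n S) = n :=
  (exists_comp n (S ∩ Finset.Ioo 0 n) Finset.inter_subset_right).choose_spec.1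

theorem partialSums_ofPartialSums {n : ℕ} {S : Finset ℕ} (hS : S ⊆ Finset.Ioo 0 n) :
    partialSums (ofPartialSums n S) = S := by
  have := (exists_comp n (S ∩ Finset.Ioo 0 n) Finset.inter_subset_right).choose_spec.2
  exact this.trans (Finset.inter_eq_left.2 hS)

/-- The ribbon basis `R_α = ∑_β (-1)^{ℓ(α) - ℓ(β)} H_β`, the sum over the compositions `β` of `|α|`
with `D(β) ⊆ D(α)`. It is the basis of `NSym` dual to `(F_α)`: see `pairing_R_F`, `span_R` and
`nsym_ext`. -/
def R (k : Type*) [CommRing k] (α : Comp) : NSym k :=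
  ∑ S ∈ (partialSums α).powerset,
    (-1 : k) ^ (partialSums α \ S).card • H k (ofPartialSums (size α) S)

/-- `(R_α, F_β) = δ_{α,β}`. -/
theorem pairing_R_F (α β : Comp) : pairing k (R k α) (F k β) = if α = β then 1 else 0 := by
  classical
  have hterm : ∀ S ∈ (partialSums α).powerset,
      pairing k (H k (ofPartialSums (size α) S)) (F k β) =
        if size α = size β ∧ partialSums β ⊆ S then 1 else 0 := by
    intro S hS
    rw [pairing_H_F, size_ofPartialSums,
      partialSums_ofPartialSums ((Finset.mem_powerset.1 hS).trans (partialSums_subset α))]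
  rw [R, map_sum, LinearMap.sum_apply]
  simp only [map_smul, LinearMap.smul_apply]
  rw [Finset.sum_congr rfl fun S hS => by rw [hterm S hS]]
  by_cases hs : size α = size β
  swap
  · rw [if_neg (fun h => hs (congrArg size h))]
    simp [hs]
  by_cases hD : partialSums β ⊆ partialSums α
  swap
  · rw [if_neg (fun h => hD (by rw [h]))]
    refine Finset.sum_eq_zero fun S hS => ?_
    rw [if_neg (fun h => hD (h.2.trans (Finset.mem_powerset.1 hS))), smul_zero]
  have key : ∑ S ∈ (partialSums α).powerset, (-1 : k) ^ (partialSums α \ S).card •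
      (if size α = size β ∧ partialSums β ⊆ S then (1 : k) else 0) =
      ∑ T ∈ (partialSums α \ partialSums β).powerset, (-1 : k) ^ T.card := by
    simp only [hs, true_and, smul_eq_mul, mul_ite, mul_one, mul_zero]
    rw [← Finset.sum_filter]
    refine Finset.sum_nbij' (fun S => partialSums α \ S) (fun T => partialSums α \ T)
      ?_ ?_ ?_ ?_ ?_
    · intro S hS
      simp only [Finset.mem_filter, Finset.mem_powerset] at hS ⊢
      exact Finset.sdiff_subset_sdiff subset_rfl hS.2
    · intro T hT
      simp only [Finset.mem_filter, Finset.mem_powerset] at hT ⊢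
      refine ⟨Finset.sdiff_subset, fun x hx => Finset.mem_sdiff.2 ⟨hD hx, fun h => ?_⟩⟩
      exact (Finset.mem_sdiff.1 (hT h)).2 hx
    · intro S hS
      simp only [Finset.mem_filter, Finset.mem_powerset] at hS
      exact Finset.sdiff_sdiff_eq_self hS.1
    · intro T hT
      exact Finset.sdiff_sdiff_eq_self ((Finset.mem_powerset.1 hT).trans Finset.sdiff_subset)
    · intro S _
      rfl
  rw [key]
  have h2 := congrArg (Int.cast : ℤ → k)
    (Finset.sum_powerset_neg_one_pow_card (x := partialSums α \ partialSums β))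
  push_cast at h2
  rw [h2]
  by_cases h : α = β
  · subst h; simp
  · rw [if_neg h, if_neg]
    intro h3
    exact h (comp_ext hs ((Finset.sdiff_eq_empty_iff_subset.1 h3).antisymm hD))

theorem H_mem_span_R (γ : Comp) : H k γ ∈ Submodule.span k (Set.range (R k)) := by
  induction h : (partialSums γ).card using Nat.strong_induction_on generalizing γ with
  | _ n ih =>
    have h1 : R k γ = H k γ + ∑ S ∈ (partialSums γ).powerset.erase (partialSums γ),
        (-1 : k) ^ (partialSums γ \ S).card • H k (ofPartialSums (size γ) S) := by
      rw [R, ← Finset.add_sum_erase _ _ (Finset.mem_powerset_self _),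
        comp_ext (size_ofPartialSums _ _) (partialSums_ofPartialSums (partialSums_subset γ))]
      simp
    rw [eq_sub_of_add_eq h1.symm]
    refine Submodule.sub_mem _ (Submodule.subset_span ⟨γ, rfl⟩)
      (Submodule.sum_mem _ fun S hS => Submodule.smul_mem _ _ ?_)
    rw [Finset.mem_erase, Finset.mem_powerset] at hS
    refine ih _ ?_ _ rfl
    rw [partialSums_ofPartialSums (hS.2.trans (partialSums_subset γ)), ← h]
    exact Finset.card_lt_card (Finset.ssubset_iff_subset_ne.2 ⟨hS.2, hS.1⟩)

/-- The `R_α` span `NSym`. -/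
theorem span_R : Submodule.span k (Set.range (R k)) = ⊤ := by
  refine Submodule.eq_top_iff'.2 fun a => ?_
  rw [← (MonoidAlgebra.basis (FreeMonoid ℕ+) k).linearCombination_repr a,
    Finsupp.linearCombination_apply]
  refine Submodule.sum_mem _ fun w _ => Submodule.smul_mem _ _ ?_
  simpa [H] using H_mem_span_R (k := k) w.toList

/-- An element of `NSym` is determined by its pairings with the fundamental basis. -/
theorem nsym_ext {g g' : NSym k} (h : ∀ β, pairing k g (F k β) = pairing k g' (F k β)) :
    g = g' := by
  classical
  have hspan : g - g' ∈ Submodule.span k (Set.range (R k)) := by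
    rw [span_R]
    exact Submodule.mem_top
  obtain ⟨c, hc⟩ := Finsupp.mem_span_range_iff_exists_finsupp.1 hspan
  have h0 : c = 0 := by
    ext β
    have h1 : pairing k (g - g') (F k β) = 0 := by
      rw [map_sub, LinearMap.sub_apply, h, sub_self]
    rw [← hc, Finsupp.sum, map_sum, LinearMap.sum_apply] at h1
    simpa [pairing_R_F] using h1
  rw [h0, Finsupp.sum_zero_index] at hc
  exact sub_eq_zero.1 hc.symm

/-- The `k`-bilinear continuous operation on power series that sends a pair of monomials `(m, n)` to
`m n` if `P m n` holds and to `0` otherwise: explicitly,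
`(∑ λ_m m, ∑ μ_n n) ↦ ∑_{P m n} λ_m μ_n m n`. -/
def restrictedMul (P : (ℕ →₀ ℕ) → (ℕ →₀ ℕ) → Prop) [DecidableRel P]
    (a b : MvPowerSeries ℕ k) : MvPowerSeries ℕ k := fun d =>
  ∑ p ∈ Finset.HasAntidiagonal.antidiagonal d,
    if P p.1 p.2 then MvPowerSeries.coeff p.1 a * MvPowerSeries.coeff p.2 b else 0

/-- The operation `≺`: the condition is `min (Supp m) < min (Supp n)`, where `min ∅ = ∞` is greater
than every integer but not greater than itself (the minimum is taken in `WithTop ℕ`). -/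
def dless (a b : MvPowerSeries ℕ k) : MvPowerSeries ℕ k :=
  restrictedMul (fun m n => m.support.min < n.support.min) a b

/-- The operation `⋗` (belgthor): the condition is `max (Supp m) ≤ min (Supp n)`, where `max ∅ = 0`
and `min ∅ = ∞`, i.e. every element of `Supp m` is at most every element of `Supp n`. -/
def bel (a b : MvPowerSeries ℕ k) : MvPowerSeries ℕ k :=
  restrictedMul (fun m n => ∀ i ∈ m.support, ∀ j ∈ n.support, i ≤ j) a b

end

end QuasiSymm

end

namespace QuasiSymm

/-! ### Compositions and their partial sums -/

/-! Compare coefficients of a monomial `d`. On the left, `d` is written as a product `p * q * r`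
with `p` from `F_α`, `q` from `a`, `r` from `R_{ω(α)}^⊥ f`, subject to max Supp `p` ≤ min Supp `q`.
By adjointness the coefficient of `r` in `R_{ω(α)}^⊥ f` is the pairing of `R_{ω(α)} * H_{pack r}`
with `f`. Hence the sum over `α` can be carried out inside `NSym`: it replaces `p` by `A(γ) = ∑_α
(-1)^|α| (H_γ, F_α) R_{ω(α)}` with `γ = pack p`. Since `H_γ = ∑_α (H_γ, F_α) R_α`, this is the
antipode of `H_γ`; it is `ribbonSum`, with the sum cut off at size `N`.

Now fix `q` and put `e = p * r`. The factor `p` may use only the variables in the initial segment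
`J` of indices not exceeding any index of `q`. Suppose that `e` contains a variable from `J`. Then
its least variable `x_i` lies in `J`, and its exponent may be distributed freely between `p` and
`r`. For fixed remaining factors, the sum over these distributions has the factor `∑_{x+y=n} A(x, γ)
H_y` with `n > 0`, which vanishes (`sum_ribbonSum_mul_H`). If `e` contains no variable from `J`,
then only `p = 1` contributes, and it gives `H_{pack e}`. This is `sum_ribbonSum_mul_H_pack`.

So the surviving terms are the pairs `(q, e)` in which every index of `e` exceeds some index of `q`.
For `q ≠ 1` this is the condition defining `q ≺ e`. For `q = 1` it forces `e = 1`, and this pair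
gives the extra term `ε(a)ε(f)`, because `1 ≺ 1 = 0`.

The vanishing relation needs no Hopf algebra: pairing it with each `F_β` turns it into a signed
count of the cut positions `y`, which telescopes (`alternating_sum_almost_initial`). -/

theorem mem_partialSums {α : Comp} {x : ℕ} :
    x ∈ partialSums α ↔ ∃ i, 0 < i ∧ i < α.length ∧ size (α.take i) = x := by
  simp [partialSums, and_assoc]

theorem mem_partialSums_cons {a : ℕ+} {γ : Comp} {x : ℕ} :
    x ∈ partialSums (a :: γ) ↔
      (a : ℕ) ≤ x ∧ x < a + size γ ∧ (x = a ∨ x - a ∈ partialSums γ) := by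
  rcases γ with _ | ⟨b, γ⟩
  · simp
    omega
  · rw [partialSums_cons_cons]
    simp only [Finset.mem_insert, Finset.mem_image, size_cons]
    have hb := b.pos
    constructor
    · rintro (rfl | ⟨y, hy, rfl⟩)
      · refine ⟨le_rfl, ?_, Or.inl rfl⟩
        omega
      · have := Finset.mem_Ioo.1 (partialSums_subset _ hy)
        rw [size_cons] at this
        refine ⟨by omega, by omega, Or.inr ?_⟩
        simpa using hy
    · rintro ⟨h1, h2, h3 | h3⟩
      · exact Or.inl h3
      · exact Or.inr ⟨_, h3, by omega⟩

theorem mem_partialSums_append_singleton {γ : Comp} {b : ℕ+} {x : ℕ} :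
    x ∈ partialSums (γ ++ [b]) ↔ 0 < x ∧ (x = size γ ∨ x ∈ partialSums γ) := by
  constructor
  · intro h
    refine ⟨(Finset.mem_Ioo.1 (partialSums_subset _ h)).1, ?_⟩
    obtain ⟨i, h0, h1, rfl⟩ := mem_partialSums.1 h
    have hi : i ≤ γ.length := by simpa [Nat.lt_succ_iff] using h1
    rw [List.take_append_of_le_length hi]
    rcases hi.eq_or_lt with h2 | h2
    · left
      rw [h2, List.take_length]
    · exact Or.inr (mem_partialSums.2 ⟨i, h0, h2, rfl⟩)
  · rintro ⟨h0, rfl | h⟩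
    · refine mem_partialSums.2 ⟨γ.length, ?_, by simp, by simp⟩
      rw [List.length_pos_iff]
      rintro rfl
      simp at h0
    · obtain ⟨i, hi, h1, rfl⟩ := mem_partialSums.1 h
      exact mem_partialSums.2 ⟨i, hi, by simp; omega, by rw [List.take_append_of_le_length h1.le]⟩

theorem size_reverse (α : Comp) : size α.reverse = size α := by
  simp [size, List.sum_reverse]

theorem mem_partialSums_reverse {α : Comp} {x : ℕ} :
    x ∈ partialSums α.reverse ↔ 0 < x ∧ x < size α ∧ size α - x ∈ partialSums α := by
  induction α generalizing x with
  | nil => simp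
  | cons a α ih =>
    have ha := a.pos
    have hsub : ∀ {y}, y ∈ partialSums α → 0 < y ∧ y < size α := fun h =>
      Finset.mem_Ioo.1 (partialSums_subset _ h)
    rw [List.reverse_cons, mem_partialSums_append_singleton, mem_partialSums_cons, size_reverse, ih,
      size_cons]
    constructor
    · rintro ⟨h0, rfl | ⟨_, h1, h2⟩⟩
      · exact ⟨h0, by omega, by omega, by omega, by omega⟩
      · refine ⟨h0, by omega, by omega, by omega, Or.inr ?_⟩
        rwa [show (a : ℕ) + size α - x - a = size α - x by omega]
    · rintro ⟨h0, h1, h2, h3, h4 | h4⟩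
      · exact ⟨h0, by omega⟩
      · have := hsub h4
        refine ⟨h0, Or.inr ⟨h0, by omega, ?_⟩⟩
        rwa [show (a : ℕ) + size α - x - a = size α - x by omega] at h4

/-! ### The involution `ω` -/

theorem size_omegaComp (α : Comp) : size (omegaComp α) = size α := (omegaComp_spec α).1

theorem mem_partialSums_omegaComp {α : Comp} {x : ℕ} :
    x ∈ partialSums (omegaComp α) ↔ 0 < x ∧ x < size α ∧ size α - x ∉ partialSums α := by
  rw [(omegaComp_spec α).2, Finset.mem_sdiff, Finset.mem_Ioo, mem_partialSums_reverse]
  tauto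

/-- On subsets of `{1, …, n - 1}`, complementation and the reflection `x ↦ n - x` are commuting
involutions. -/
theorem omegaComp_omegaComp (α : Comp) : omegaComp (omegaComp α) = α := by
  refine comp_ext (by simp [size_omegaComp]) (Finset.ext fun x => ?_)
  rw [mem_partialSums_omegaComp, mem_partialSums_omegaComp, size_omegaComp]
  have hsub : x ∈ partialSums α → 0 < x ∧ x < size α := fun h =>
    Finset.mem_Ioo.1 (partialSums_subset _ h)
  constructor
  · rintro ⟨h0, h1, h2⟩
    by_contra h
    refine h2 ⟨by omega, by omega, ?_⟩
    rwa [show size α - (size α - x) = x by omega]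
  · intro h
    obtain ⟨h0, h1⟩ := hsub h
    refine ⟨h0, h1, fun h2 => h2.2.2 ?_⟩
    rwa [show size α - (size α - x) = x by omega]

theorem omegaComp_eq_iff {α β : Comp} : omegaComp α = β ↔ α = omegaComp β :=
  ⟨fun h => by rw [← h, omegaComp_omegaComp], fun h => by rw [h, omegaComp_omegaComp]⟩

theorem finite_size_le (N : ℕ) : {α : Comp | size α ≤ N}.Finite := by
  refine Set.Finite.of_finite_image (f := fun α => (size α, partialSums α))
    (((Finset.range (N + 1)) ×ˢ (Finset.range N).powerset).finite_toSet.subset ?_)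
    (fun α _ β _ h => comp_ext (Prod.ext_iff.1 h).1 (Prod.ext_iff.1 h).2)
  rintro _ ⟨α, hα, rfl⟩
  have hα' : size α ≤ N := hα
  simp only [Finset.coe_product, Set.mem_prod, Finset.mem_coe, Finset.mem_range,
    Finset.mem_powerset]
  refine ⟨by omega, fun x hx => ?_⟩
  have := Finset.mem_Ioo.1 (partialSums_subset _ hx)
  rw [Finset.mem_range]
  omega

/-- The compositions of size at most `N`. -/
noncomputable def compsLE (N : ℕ) : Finset Comp := (finite_size_le N).toFinset

theorem mem_compsLE {N : ℕ} {α : Comp} : α ∈ compsLE N ↔ size α ≤ N := by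
  simp [compsLE]

/-- Prepends the part `n` to a composition, if `n` is positive. -/
def consNat (n : ℕ) (γ : Comp) : Comp := if h : 0 < n then n.toPNat h :: γ else γ

@[simp] theorem consNat_zero (γ : Comp) : consNat 0 γ = γ := rfl

theorem consNat_of_pos {n : ℕ} (h : 0 < n) (γ : Comp) : consNat n γ = n.toPNat h :: γ := dif_pos h

@[simp] theorem size_consNat (n : ℕ) (γ : Comp) : size (consNat n γ) = n + size γ := by
  rcases Nat.eq_zero_or_pos n with rfl | h
  · simp
  · rw [consNat_of_pos h, size_cons]
    rfl

theorem consNat_append (n : ℕ) (γ δ : Comp) : consNat n γ ++ δ = consNat n (γ ++ δ) := by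
  rcases Nat.eq_zero_or_pos n with rfl | h
  · simp
  · rw [consNat_of_pos h, consNat_of_pos h, List.cons_append]

theorem mem_partialSums_consNat {n : ℕ} {γ : Comp} {x : ℕ} :
    x ∈ partialSums (consNat n γ) ↔
      0 < x ∧ n ≤ x ∧ x < n + size γ ∧ (x = n ∨ x - n ∈ partialSums γ) := by
  rcases Nat.eq_zero_or_pos n with rfl | h
  · have hsub : x ∈ partialSums γ → 0 < x ∧ x < size γ := fun h =>
      Finset.mem_Ioo.1 (partialSums_subset _ h)
    simp only [consNat_zero, Nat.sub_zero, zero_add]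
    constructor
    · intro h
      exact ⟨(hsub h).1, by omega, (hsub h).2, Or.inr h⟩
    · rintro ⟨h0, h1, h2, h3 | h3⟩
      · omega
      · exact h3
  · rw [consNat_of_pos h, mem_partialSums_cons]
    change n ≤ x ∧ x < n + size γ ∧ (x = n ∨ x - n ∈ partialSums γ) ↔ _
    constructor
    · rintro ⟨h1, h2, h3⟩
      exact ⟨by omega, h1, h2, h3⟩
    · exact fun h => h.2

theorem mem_partialSums_append_consNat {γ : Comp} {n : ℕ} {x : ℕ} :
    x ∈ partialSums (γ ++ consNat n []) ↔
      (0 < x ∧ 0 < n ∧ x = size γ) ∨ x ∈ partialSums γ := by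
  have hsub : x ∈ partialSums γ → 0 < x := fun h =>
    (Finset.mem_Ioo.1 (partialSums_subset _ h)).1
  rcases Nat.eq_zero_or_pos n with rfl | h
  · simp
  · rw [consNat_of_pos h, mem_partialSums_append_singleton]
    tauto

/-- The composition of `size β - b` obtained from `β` by removing `b` from its end. -/
noncomputable def truncate (β : Comp) (b : ℕ) : Comp :=
  ofPartialSums (size β - b) (partialSums β ∩ Finset.Ioo 0 (size β - b))

theorem size_truncate (β : Comp) (b : ℕ) : size (truncate β b) = size β - b :=
  size_ofPartialSums _ _

theorem mem_partialSums_truncate {β : Comp} {b x : ℕ} :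
    x ∈ partialSums (truncate β b) ↔ x ∈ partialSums β ∧ x < size β - b := by
  rw [truncate, partialSums_ofPartialSums Finset.inter_subset_right, Finset.mem_inter,
    Finset.mem_Ioo]
  have hsub : x ∈ partialSums β → 0 < x := fun h =>
    (Finset.mem_Ioo.1 (partialSums_subset _ h)).1
  tauto

variable {k : Type*} [CommRing k]

/-! ### The ribbon sums dual to the antipode -/

/-- Multiplying by `H_b` on the right appends a part `b`, so the pairing is nonzero only if `β` has
no break strictly inside its last `b` places. Whether `β` breaks at `size β - b` itself is
irrelevant: hence `≤` in the condition, and `truncate` forgets that break. -/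
theorem pairing_H_mul_H_F (δ β : Comp) (b : ℕ) :
    pairing k (H k δ * H k (consNat b [])) (F k β) =
      if b ≤ size β ∧ ∀ x ∈ partialSums β, x ≤ size β - b then
        pairing k (H k δ) (F k (truncate β b)) else 0 := by
  rw [H_mul_H, pairing_H_F, pairing_H_F, ← ite_and]
  refine if_congr ?_ rfl rfl
  rw [size_append, size_consNat, size_nil, add_zero, size_truncate]
  have hsub : ∀ x ∈ partialSums β, 0 < x ∧ x < size β := fun x h =>
    Finset.mem_Ioo.1 (partialSums_subset _ h)
  have hsub' : ∀ x ∈ partialSums δ, 0 < x ∧ x < size δ := fun x h =>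
    Finset.mem_Ioo.1 (partialSums_subset _ h)
  constructor
  · rintro ⟨h1, h2⟩
    refine ⟨⟨by omega, fun x hx => ?_⟩, by omega, fun x hx => ?_⟩
    · rcases mem_partialSums_append_consNat.1 (h2 hx) with h | h
      · omega
      · have := hsub' x h
        omega
    · rw [mem_partialSums_truncate] at hx
      rcases mem_partialSums_append_consNat.1 (h2 hx.1) with h | h
      · omega
      · exact h
  · rintro ⟨⟨h1, h2⟩, h3, h4⟩
    refine ⟨by omega, fun x hx => mem_partialSums_append_consNat.2 ?_⟩
    have := h2 x hx
    have := hsub x hx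
    by_cases h : x = size δ
    · left
      omega
    · exact Or.inr (h4 (mem_partialSums_truncate.2 ⟨hx, by omega⟩))

theorem pairing_mul_H_F (g : NSym k) (β : Comp) (b : ℕ) :
    pairing k (g * H k (consNat b [])) (F k β) =
      if b ≤ size β ∧ ∀ x ∈ partialSums β, x ≤ size β - b then
        pairing k g (F k (truncate β b)) else 0 := by
  have h : (pairing k).flip (F k β) ∘ₗ LinearMap.mulRight k (H k (consNat b [])) =
      if b ≤ size β ∧ ∀ x ∈ partialSums β, x ≤ size β - b then
        (pairing k).flip (F k (truncate β b)) else 0 := by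
    apply nsym_linear_ext
    intro δ
    refine (pairing_H_mul_H_F δ β b).trans ?_
    split_ifs <;> rfl
  refine (LinearMap.congr_fun h g).trans ?_
  split_ifs <;> rfl

/-- The sum `∑ (-1)^|α| R_{ω(α)}` over the compositions `α` of size at most `N` for which the
monomials with exponents `γ` occur in `F_α`. -/
noncomputable def ribbonSum (k : Type*) [CommRing k] (N : ℕ) (γ : Comp) : NSym k :=
  ∑ α ∈ compsLE N, ((-1 : k) ^ size α * pairing k (H k γ) (F k α)) • R k (omegaComp α)

/-- Duality of `R` and `F` leaves only the summand `α = ω(β)`; the bound on `γ` ensures that it is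
not cut off whenever its coefficient is nonzero. -/
theorem pairing_ribbonSum_F {N : ℕ} {γ : Comp} (hγ : size γ ≤ N) (β : Comp) :
    pairing k (ribbonSum k N γ) (F k β) =
      if size γ = size β ∧ partialSums (omegaComp β) ⊆ partialSums γ then
        (-1 : k) ^ size γ else 0 := by
  classical
  rw [ribbonSum, map_sum, LinearMap.sum_apply]
  simp only [map_smul, LinearMap.smul_apply, pairing_R_F, omegaComp_eq_iff, smul_eq_mul, mul_ite,
    mul_one, mul_zero]
  rw [Finset.sum_ite_eq']
  simp only [mem_compsLE, pairing_H_F, size_omegaComp, mul_ite, mul_one, mul_zero]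
  by_cases h : size γ = size β
  · rw [if_pos (by omega), h]
  · simp [h]

/-! ### Cancellation in the relation `∑ A_x H_y = 0` -/

theorem alternating_sum_telescope (v : ℕ → k) (m : ℕ) :
    ∑ y ∈ Finset.range m, (-1) ^ y * (v y + v (y + 1)) = v 0 - (-1) ^ m * v m := by
  induction m with
  | zero => simp
  | succ m ih =>
    rw [Finset.sum_range_succ, ih]
    ring

open Classical in
-- The condition says nothing about `C y`. So it holds at `y` exactly when, within `0 < z < n`, the
-- set where `C` holds is `{z < y}` or `{z < y + 1}`. A set of this form is therefore counted at two
-- consecutive `y`, with opposite signs.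
theorem alternating_sum_almost_initial (C : ℕ → Prop) {n : ℕ} (hn : 0 < n) :
    ∑ y ∈ Finset.range (n + 1), (-1 : k) ^ y *
      (if (∀ z, 0 < z → z < y → C z) ∧ (∀ z, y < z → z < n → ¬ C z) then 1 else 0) = 0 := by
  -- The bounds `0 < y ≤ n` make each initial segment of `{1, …, n - 1}` correspond to exactly one
  -- `y`, and make both boundary terms `v 0` and `v (n + 1)` of the telescoping sum vanish.
  let v : ℕ → k := fun y =>
    if 0 < y ∧ y ≤ n ∧ ∀ z, 0 < z → z < n → (C z ↔ z < y) then 1 else 0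
  have h : ∀ y ∈ Finset.range (n + 1), (-1 : k) ^ y *
      (if (∀ z, 0 < z → z < y → C z) ∧ (∀ z, y < z → z < n → ¬ C z) then 1 else 0) =
      (-1) ^ y * (v y + v (y + 1)) := by
    intro y hy
    have hy' := Finset.mem_range.1 hy
    congr 1
    by_cases h1 : (∀ z, 0 < z → z < y → C z) ∧ (∀ z, y < z → z < n → ¬ C z)
    · rw [if_pos h1]
      have hC : ∀ z, 0 < z → z < n → z ≠ y → (C z ↔ z < y) := by
        intro z h0 hz hzy
        rcases lt_or_gt_of_ne hzy with h2 | h2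
        · exact ⟨fun _ => h2, fun _ => h1.1 z h0 h2⟩
        · exact ⟨fun h3 => absurd h3 (h1.2 z h2 hz), fun h3 => by omega⟩
      -- This decides which of the two segments occurs: `{z < y}` if `C y` fails or `y = n`, and `{z
      -- < y + 1}` if `C y` holds or `y = 0`.
      by_cases hv : 0 < y ∧ (y < n → ¬ C y)
      · have e1 : v y = 1 := if_pos ⟨hv.1, by omega, fun z h0 hz => by
          by_cases hzy : z = y
          · subst hzy
            exact ⟨fun h3 => absurd h3 (hv.2 hz), fun h3 => by omega⟩
          · exact hC z h0 hz hzy⟩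
        have e2 : v (y + 1) = 0 := if_neg (fun h => by
          have h3 : y < n := by omega
          exact hv.2 h3 ((h.2.2 y hv.1 h3).2 (by omega)))
        rw [e1, e2, add_zero]
      · have hyn : y < n := by
          by_contra h3
          exact hv ⟨by omega, fun h4 => absurd h4 h3⟩
        have hCy : 0 < y → C y := fun h0 => by
          by_contra h4
          exact hv ⟨h0, fun _ => h4⟩
        have e1 : v y = 0 := if_neg (fun h => by
          have := (h.2.2 y h.1 hyn).1 (hCy h.1)
          omega)
        have e2 : v (y + 1) = 1 := if_pos ⟨by omega, by omega, fun z h0 hz => by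
          by_cases hzy : z = y
          · subst hzy
            exact ⟨fun _ => by omega, fun _ => hCy h0⟩
          · rw [hC z h0 hz hzy]
            omega⟩
        rw [e1, e2, zero_add]
    · rw [if_neg h1]
      have e1 : v y = 0 := if_neg (fun h => h1 ⟨fun z h0 hz => (h.2.2 z h0 (by omega)).2 hz,
        fun z hz hzn hc => by
          have := (h.2.2 z (by omega) hzn).1 hc
          omega⟩)
      have e2 : v (y + 1) = 0 := if_neg (fun h => h1
        ⟨fun z h0 hz => (h.2.2 z h0 (by omega)).2 (by omega), fun z hz hzn hc => by
          have := (h.2.2 z (by omega) hzn).1 hc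
          omega⟩)
      rw [e1, e2, add_zero]
  rw [Finset.sum_congr rfl h, alternating_sum_telescope]
  have e1 : v 0 = 0 := if_neg (fun h => by omega)
  have e2 : v (n + 1) = 0 := if_neg (fun h => by omega)
  rw [e1, e2, mul_zero, sub_zero]

/-- Places are measured by their distance `z` from the right end of `β`. The last `y` places contain
no break of `β`; the next `x` places, where `ω` has no break, must all be breaks of `β`; what lies
beyond depends on `x` and `y` only through `x + y`. The place `z = y` is unconstrained, which is
what lets the alternating sum cancel. -/
theorem truncate_condition_iff {β γ : Comp} {x y : ℕ} :
    ((y ≤ size β ∧ ∀ z ∈ partialSums β, z ≤ size β - y) ∧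
      size (consNat x γ) = size (truncate β y) ∧
      partialSums (omegaComp (truncate β y)) ⊆ partialSums (consNat x γ)) ↔
    (size β = x + y + size γ ∧ ∀ z, x + y < z → z < size β → size β - z ∉ partialSums β →
      z - (x + y) ∈ partialSums γ) ∧
    (∀ z, 0 < z → z < y → size β - z ∉ partialSums β) ∧
      ∀ z, y < z → z < x + y → ¬ size β - z ∉ partialSums β := by
  have hsub : ∀ x ∈ partialSums β, 0 < x ∧ x < size β := fun x h =>
    Finset.mem_Ioo.1 (partialSums_subset _ h)
  rw [size_consNat, size_truncate]
  constructor
  · rintro ⟨⟨h1, h2⟩, h3, h4⟩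
    have key : ∀ z, y < z → z < size β → size β - z ∉ partialSums β →
        z - y ∈ partialSums (consNat x γ) := by
      intro z hz hzs h
      refine h4 (mem_partialSums_omegaComp.2 ⟨by omega, by rw [size_truncate]; omega, fun h5 => h ?_⟩)
      rw [mem_partialSums_truncate, size_truncate] at h5
      rw [show size β - z = size β - y - (z - y) by omega]
      exact h5.1
    refine ⟨⟨by omega, fun z hz hzs h => ?_⟩, fun z h0 hz h => ?_, fun z hz hzn h => ?_⟩
    · obtain ⟨_, _, _, h5⟩ := mem_partialSums_consNat.1 (key z (by omega) hzs h)
      rw [show z - (x + y) = z - y - x by omega]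
      exact h5.resolve_left (by omega)
    · have := h2 _ h
      have := hsub _ h
      omega
    · obtain ⟨_, _, _, _⟩ := mem_partialSums_consNat.1 (key z (by omega) (by omega) h)
      omega
  · rintro ⟨⟨h1, h2⟩, h3, h4⟩
    refine ⟨⟨by omega, fun z hz => ?_⟩, by omega, fun z hz => ?_⟩
    · by_contra h
      have := hsub z hz
      refine h3 (size β - z) (by omega) (by omega) ?_
      rwa [show size β - (size β - z) = z by omega]
    · rw [mem_partialSums_omegaComp, mem_partialSums_truncate, size_truncate] at hz
      obtain ⟨h0, hz1, hz2⟩ := hz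
      have hz3 : size β - (z + y) ∉ partialSums β := fun h => hz2
        ⟨by rwa [show size β - y - z = size β - (z + y) by omega], by omega⟩
      have hxz : x ≤ z := by
        by_contra h
        exact h4 (z + y) (by omega) (by omega) hz3
      refine mem_partialSums_consNat.2 ⟨h0, hxz, by omega, ?_⟩
      rcases hxz.eq_or_lt with h | h
      · exact Or.inl h.symm
      · have := h2 (z + y) (by omega) (by omega) hz3
        rw [show z + y - (x + y) = z - x by omega] at this
        exact Or.inr this

/-- The relation `∑ A_x H_y = 0` over `x + y = n`, where `A` stands for the antipode of `H`. -/
theorem sum_ribbonSum_mul_H {N n : ℕ} (hn : 0 < n) (γ : Comp) (hN : n + size γ ≤ N) :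
    ∑ p ∈ Finset.HasAntidiagonal.antidiagonal n,
      ribbonSum k N (consNat p.1 γ) * H k (consNat p.2 []) = 0 := by
  classical
  apply nsym_ext
  intro β
  rw [map_sum, LinearMap.sum_apply, map_zero, LinearMap.zero_apply]
  -- The first factor does not depend on `p`. The sign is `(-1) ^ (x + size γ)`, rewritten as `(-1)
  -- ^ (n + size γ) * (-1) ^ y`.
  have hterm : ∀ p ∈ Finset.HasAntidiagonal.antidiagonal n,
      pairing k (ribbonSum k N (consNat p.1 γ) * H k (consNat p.2 [])) (F k β) =
      (if size β = n + size γ ∧ ∀ z, n < z → z < size β → size β - z ∉ partialSums β →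
        z - n ∈ partialSums γ then (-1 : k) ^ (n + size γ) else 0) * ((-1) ^ p.2 *
        (if (∀ z, 0 < z → z < p.2 → size β - z ∉ partialSums β) ∧
          (∀ z, p.2 < z → z < n → ¬ size β - z ∉ partialSums β) then 1 else 0)) := by
    rintro ⟨x, y⟩ hp
    obtain rfl : x + y = n := Finset.HasAntidiagonal.mem_antidiagonal.1 hp
    dsimp only
    rw [pairing_mul_H_F, pairing_ribbonSum_F (by rw [size_consNat]; omega), ← ite_and, mul_ite,
      mul_one, mul_zero, ite_zero_mul_ite_zero, if_congr truncate_condition_iff rfl rfl,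
      size_consNat]
    refine if_congr Iff.rfl ?_ rfl
    rw [show x + y + size γ = x + size γ + y by omega, pow_add _ (x + size γ) y, mul_assoc,
      ← pow_add, ← two_mul, pow_mul]
    simp
  rw [Finset.sum_congr rfl hterm, ← Finset.mul_sum, ← Finset.Nat.sum_antidiagonal_swap]
  have h := alternating_sum_almost_initial (k := k) (fun z => size β - z ∉ partialSums β) hn
  rw [← Finset.Nat.sum_antidiagonal_eq_sum_range_succ_mk (M := k) (n := n)
    (f := fun p => (-1 : k) ^ p.1 *
      (if (∀ z, 0 < z → z < p.1 → size β - z ∉ partialSums β) ∧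
        (∀ z, p.1 < z → z < n → ¬ size β - z ∉ partialSums β) then 1 else 0))] at h
  refine mul_eq_zero_of_right _ (Eq.trans ?_ h)
  exact Finset.sum_congr rfl fun p _ => rfl


/-! ### Monomials -/

theorem size_pack (m : ℕ →₀ ℕ) : size (pack m) = m.degree := by
  obtain ⟨i, _, h⟩ := exists_monoAt m
  conv_rhs => rw [h]
  rw [degree_monoAt]

theorem pairing_H_pack (m : ℕ →₀ ℕ) (f : QSym k) :
    pairing k (H k (pack m)) f = MvPowerSeries.coeff m (f : MvPowerSeries ℕ k) := by
  obtain ⟨i, hi, h⟩ := exists_monoAt m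
  rw [pairing_H_eq_coeff f hi, ← h]

@[simp] theorem pack_zero : pack 0 = [] := by
  rw [← size_eq_zero, size_pack, map_zero]

theorem pack_single_add {i x : ℕ} {p : ℕ →₀ ℕ} (hp : ∀ j ∈ p.support, i < j) :
    pack (Finsupp.single i x + p) = consNat x (pack p) := by
  rcases Nat.eq_zero_or_pos x with rfl | hx
  · simp
  have hi : i ∉ p.support := fun h => lt_irrefl _ (hp i h)
  have hval : (Finsupp.single i x + p) i = x := by
    simp [Finsupp.notMem_support_iff.1 hi]
  have hother : ∀ j, j ≠ i → (Finsupp.single i x + p) j = p j := fun j hj => by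
    simp [Finsupp.single_eq_of_ne hj]
  have hsupp : (Finsupp.single i x + p).support = insert i p.support := by
    ext j
    rw [Finset.mem_insert, Finsupp.mem_support_iff, Finsupp.mem_support_iff]
    by_cases hj : j = i
    · subst hj
      simp [hval, hx.ne']
    · simp [hother j hj, hj]
  rw [consNat_of_pos hx, pack, hsupp, Finset.sort_insert _ (fun j hj => (hp j hj).le) hi,
    List.map_cons, hval]
  congr 1
  · apply PNat.coe_injective
    rw [Nat.toPNat'_coe, if_pos hx]
    rfl
  · refine List.map_congr_left fun j hj => ?_
    rw [hother j fun h => hi (h ▸ (Finset.mem_sort _).1 hj)]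

/-- A factorization of a monomial amounts to independent factorizations of its `x_i`-power and of
the rest. This isolates the variable at which the cancellation happens. -/
theorem sum_antidiagonal_erase {V : Type*} [AddCommMonoid V] (e : ℕ →₀ ℕ) (i : ℕ)
    (g : (ℕ →₀ ℕ) × (ℕ →₀ ℕ) → V) :
    ∑ p ∈ Finset.HasAntidiagonal.antidiagonal e, g p =
      ∑ q ∈ Finset.HasAntidiagonal.antidiagonal (e.erase i),
        ∑ c ∈ Finset.HasAntidiagonal.antidiagonal (e i),
          g (Finsupp.single i c.1 + q.1, Finsupp.single i c.2 + q.2) := by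
  rw [← Finset.sum_product']
  have hz : ∀ {q : (ℕ →₀ ℕ) × (ℕ →₀ ℕ)}, q.1 + q.2 = e.erase i → q.1 i = 0 ∧ q.2 i = 0 := by
    intro q hq
    have := DFunLike.congr_fun hq i
    rw [Finsupp.add_apply, Finsupp.erase_same] at this
    omega
  have herase : ∀ (x : ℕ) (q : ℕ →₀ ℕ), q i = 0 → (Finsupp.single i x + q).erase i = q := by
    intro x q hq
    rw [Finsupp.erase_add, Finsupp.erase_single, zero_add, Finsupp.erase_of_notMem_support]
    simpa using hq
  refine Finset.sum_nbij' (fun p => ((p.1.erase i, p.2.erase i), (p.1 i, p.2 i)))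
    (fun q => (Finsupp.single i q.2.1 + q.1.1, Finsupp.single i q.2.2 + q.1.2)) ?_ ?_ ?_ ?_ ?_
  · rintro ⟨p, r⟩ hp
    rw [Finset.HasAntidiagonal.mem_antidiagonal] at hp
    simp only [Finset.mem_product, Finset.HasAntidiagonal.mem_antidiagonal]
    rw [← hp, Finsupp.erase_add]
    exact ⟨rfl, rfl⟩
  · rintro ⟨q, c⟩ h
    simp only [Finset.mem_product, Finset.HasAntidiagonal.mem_antidiagonal] at h ⊢
    rw [add_add_add_comm, ← Finsupp.single_add, h.1, h.2, Finsupp.single_add_erase]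
  · rintro ⟨p, r⟩ _
    simp only [Finsupp.single_add_erase]
  · rintro ⟨q, c⟩ h
    simp only [Finset.mem_product, Finset.HasAntidiagonal.mem_antidiagonal] at h
    have := hz h.1
    simp only [herase _ _ this.1, herase _ _ this.2, Finsupp.add_apply, Finsupp.single_eq_same,
      this.1, this.2, add_zero]
  · rintro ⟨p, r⟩ _
    simp only [Finsupp.single_add_erase]

/-! ### Cancellation at the least variable -/

theorem ribbonSum_nil (N : ℕ) : ribbonSum k N [] = 1 := by
  apply nsym_ext
  intro β
  have h1 : (1 : NSym k) = H k [] := rfl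
  rw [pairing_ribbonSum_F (by simp), h1, pairing_H_F, size_nil, pow_zero]
  refine if_congr (and_congr_right fun h => ?_) rfl rfl
  rw [size_eq_zero.1 h.symm, size_eq_zero.1 (size_omegaComp [])]

theorem H_consNat (n : ℕ) (γ : Comp) : H k (consNat n γ) = H k (consNat n []) * H k γ := by
  rw [H_mul_H, consNat_append, List.nil_append]

open Classical in
-- As `J` is an initial segment, if it meets the support of `e` then it contains the least index
-- there, and redistributing the exponent of that variable kills the sum. Otherwise only the trivial
-- factor `p = 0` is allowed.
theorem sum_ribbonSum_mul_H_pack {N : ℕ} (J : ℕ → Prop) (hJ : ∀ i j, i ≤ j → J j → J i)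
    (e : ℕ →₀ ℕ) (he : e.degree ≤ N) :
    ∑ p ∈ Finset.HasAntidiagonal.antidiagonal e,
      (if ∀ i ∈ p.1.support, J i then ribbonSum k N (pack p.1) * H k (pack p.2) else 0) =
      if ∀ i ∈ e.support, ¬ J i then H k (pack e) else 0 := by
  split_ifs with h
  · rw [Finset.sum_eq_single (0, e)]
    · simp [ribbonSum_nil]
    · rintro ⟨p, r⟩ hp hne
      rw [Finset.HasAntidiagonal.mem_antidiagonal] at hp
      dsimp only at hp ⊢
      refine if_neg fun hpJ => hne ?_
      have hp0 : p = 0 := by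
        ext i
        by_contra hi
        refine h i ?_ (hpJ i (Finsupp.mem_support_iff.2 hi))
        rw [Finsupp.mem_support_iff, ← hp, Finsupp.add_apply]
        rw [Finsupp.zero_apply] at hi
        omega
      rw [hp0, zero_add] at hp
      rw [hp0, hp]
    · intro h0
      simp at h0
  · push Not at h
    obtain ⟨j, hj, hjJ⟩ := h
    have hne : e.support.Nonempty := ⟨j, hj⟩
    set i := e.support.min' hne with hi
    have hiJ : J i := hJ i j (Finset.min'_le _ _ hj) hjJ
    have hei : 0 < e i := Nat.pos_of_ne_zero (Finsupp.mem_support_iff.1 (Finset.min'_mem _ hne))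
    rw [sum_antidiagonal_erase e i]
    refine Finset.sum_eq_zero fun q hq => ?_
    rw [Finset.HasAntidiagonal.mem_antidiagonal] at hq
    have hsupp : ∀ l, (e.erase i) l ≠ 0 → i < l := by
      intro l hl
      have hl' := Finsupp.mem_support_iff.2 hl
      rw [Finsupp.support_erase, Finset.mem_erase] at hl'
      exact lt_of_le_of_ne (Finset.min'_le _ _ hl'.2) hl'.1.symm
    have hq1 : ∀ l ∈ q.1.support, i < l := fun l hl => hsupp l (by
      rw [← hq, Finsupp.add_apply]
      have := Finsupp.mem_support_iff.1 hl
      omega)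
    have hq2 : ∀ l ∈ q.2.support, i < l := fun l hl => hsupp l (by
      rw [← hq, Finsupp.add_apply]
      have := Finsupp.mem_support_iff.1 hl
      omega)
    -- Since `J i` holds, the share of `x_i` given to the first factor does not affect the
    -- condition.
    have hcond : ∀ x, (∀ l ∈ (Finsupp.single i x + q.1).support, J l) ↔
        ∀ l ∈ q.1.support, J l := by
      intro x
      constructor
      · intro h l hl
        refine h l ?_
        have := Finsupp.mem_support_iff.1 hl
        rw [Finsupp.mem_support_iff, Finsupp.add_apply]
        omega
      · intro h l hl
        by_cases hli : l = i
        · rwa [hli]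
        · refine h l ?_
          rw [Finsupp.mem_support_iff, Finsupp.add_apply, Finsupp.single_eq_of_ne hli,
            zero_add] at hl
          exact Finsupp.mem_support_iff.2 hl
    simp only [hcond]
    split_ifs with h
    · have hdeg : e i + size (pack q.1) ≤ N := by
        refine le_trans ?_ he
        rw [← Finsupp.single_add_erase i e, map_add, Finsupp.degree_single, ← hq, map_add,
          size_pack]
        simp only [Finsupp.add_apply, Finsupp.single_eq_same, (Finsupp.notMem_support_iff.1
          fun h => lt_irrefl _ (hq1 i h)), (Finsupp.notMem_support_iff.1
          fun h => lt_irrefl _ (hq2 i h))]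
        omega
      -- As `i` lies below both remaining supports, its exponents become leading parts: `x` joins
      -- the argument of `ribbonSum`, while `H_y` splits off on the left of `H k (pack q.2)`.
      have h0 := congrArg (· * H k (pack q.2)) (sum_ribbonSum_mul_H (k := k) hei (pack q.1) hdeg)
      rw [zero_mul, Finset.sum_mul] at h0
      refine Eq.trans (Finset.sum_congr rfl fun c _ => ?_) h0
      rw [pack_single_add hq1, pack_single_add hq2, H_consNat, mul_assoc]
    · exact Finset.sum_const_zero

/-! ### The coefficients of the two sides -/

/-- Regroups `(p q) r` as `q (p r)`, so that the monomial `q` of `a` can be held fixed while `p` and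
`r` vary. -/
theorem sum_antidiagonal_triple {V : Type*} [AddCommMonoid V] (d : ℕ →₀ ℕ)
    (g : (ℕ →₀ ℕ) → (ℕ →₀ ℕ) → (ℕ →₀ ℕ) → V) :
    ∑ u ∈ Finset.HasAntidiagonal.antidiagonal d,
      ∑ p ∈ Finset.HasAntidiagonal.antidiagonal u.1, g p.1 p.2 u.2 =
    ∑ u ∈ Finset.HasAntidiagonal.antidiagonal d,
      ∑ p ∈ Finset.HasAntidiagonal.antidiagonal u.2, g p.1 u.1 p.2 := by
  simp only [Finset.sum_sigma']
  refine Finset.sum_nbij' (fun x => ⟨(x.2.2, x.2.1 + x.1.2), (x.2.1, x.1.2)⟩)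
    (fun x => ⟨(x.2.1 + x.1.1, x.2.2), (x.2.1, x.1.1)⟩) ?_ ?_ ?_ ?_ ?_
  · rintro ⟨⟨u, r⟩, ⟨p, q⟩⟩ h
    simp only [Finset.mem_sigma, Finset.HasAntidiagonal.mem_antidiagonal] at h ⊢
    rw [← h.1, ← h.2]
    exact ⟨by abel, trivial⟩
  · rintro ⟨⟨u, r⟩, ⟨p, q⟩⟩ h
    simp only [Finset.mem_sigma, Finset.HasAntidiagonal.mem_antidiagonal] at h ⊢
    rw [← h.1, ← h.2]
    exact ⟨by abel, trivial⟩
  · rintro ⟨⟨u, r⟩, ⟨p, q⟩⟩ h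
    simp only [Finset.mem_sigma, Finset.HasAntidiagonal.mem_antidiagonal] at h ⊢
    rw [← h.2]
  · rintro ⟨⟨u, r⟩, ⟨p, q⟩⟩ h
    simp only [Finset.mem_sigma, Finset.HasAntidiagonal.mem_antidiagonal] at h ⊢
    rw [← h.2]
  · rintro ⟨⟨u, r⟩, ⟨p, q⟩⟩ _
    rfl

/-- Nonemptiness of `s` is needed only when `t = ∅`, where both minima could be `⊤`. The second
clause is the negation of the initial-segment condition on each `i`. -/
theorem min_lt_min_iff {s t : Finset ℕ} :
    s.min < t.min ↔ s.Nonempty ∧ ∀ i ∈ t, ∃ j ∈ s, j < i := by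
  constructor
  · intro h
    have hs : s.Nonempty := by
      rw [Finset.nonempty_iff_ne_empty]
      rintro rfl
      exact not_top_lt h
    refine ⟨hs, fun i hi => ⟨s.min' hs, s.min'_mem hs, ?_⟩⟩
    have := h.trans_le (Finset.min_le hi)
    rwa [← Finset.coe_min' hs, WithTop.coe_lt_coe] at this
  · rintro ⟨hs, h⟩
    rw [← Finset.coe_min' hs]
    rcases t.eq_empty_or_nonempty with rfl | ht
    · exact WithTop.coe_lt_top _
    · rw [← Finset.coe_min' ht, WithTop.coe_lt_coe]
      obtain ⟨j, hj, hlt⟩ := h _ (t.min'_mem ht)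
      exact (s.min'_le j hj).trans_lt hlt

open Classical in
/-- The coefficients of the sum of the `(-1)^|α| (F_α ⋗ a) R_{ω(α)}^⊥ f`. -/
theorem coeff_sum_bel_mul_perp (a : MvPowerSeries ℕ k) (f : QSym k) {N : ℕ} (d : ℕ →₀ ℕ) :
    MvPowerSeries.coeff d (∑ α ∈ compsLE N, (-1 : k) ^ size α •
      (bel (F k α : MvPowerSeries ℕ k) a * (perp (R k (omegaComp α)) f : MvPowerSeries ℕ k))) =
    ∑ u ∈ Finset.HasAntidiagonal.antidiagonal d,
      ∑ p ∈ Finset.HasAntidiagonal.antidiagonal u.1,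
        MvPowerSeries.coeff p.2 a * pairing k (if ∀ i ∈ p.1.support, ∀ j ∈ p.2.support, i ≤ j then
          ribbonSum k N (pack p.1) * H k (pack u.2) else 0) f := by
  rw [map_sum]
  simp only [map_smul, MvPowerSeries.coeff_mul, smul_eq_mul, Finset.mul_sum]
  rw [Finset.sum_comm]
  refine Finset.sum_congr rfl fun u _ => ?_
  have hbel : ∀ α, MvPowerSeries.coeff u.1 (bel (F k α : MvPowerSeries ℕ k) a) =
      ∑ p ∈ Finset.HasAntidiagonal.antidiagonal u.1,
        if ∀ i ∈ p.1.support, ∀ j ∈ p.2.support, i ≤ j then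
          pairing k (H k (pack p.1)) (F k α) * MvPowerSeries.coeff p.2 a else 0 := by
    intro α
    simp only [pairing_H_pack]
    change (∑ p ∈ _, _) = _
    exact Finset.sum_congr rfl fun p _ => by congr
  simp only [hbel, Finset.mul_sum, Finset.sum_mul]
  rw [Finset.sum_comm]
  refine Finset.sum_congr rfl fun p _ => ?_
  split_ifs
  · rw [ribbonSum, Finset.sum_mul, map_sum, LinearMap.sum_apply, Finset.mul_sum]
    refine Finset.sum_congr rfl fun α _ => ?_
    rw [← pairing_H_pack, pairing_perp, smul_mul_assoc, map_smul, LinearMap.smul_apply,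
      smul_eq_mul]
    ring
  · simp

/-- Once the terms are grouped by the monomial of `a`, the cancellation lemma applies to each group.
The bound on `d` keeps every `ribbonSum` that occurs unaffected by the cutoff `N`. -/
theorem sum_bel_mul_perp_coeff (a : MvPowerSeries ℕ k) (f : QSym k) {N : ℕ} {d : ℕ →₀ ℕ}
    (hd : d.degree ≤ N) :
    MvPowerSeries.coeff d (∑ α ∈ compsLE N, (-1 : k) ^ size α •
      (bel (F k α : MvPowerSeries ℕ k) a * (perp (R k (omegaComp α)) f : MvPowerSeries ℕ k))) =
    MvPowerSeries.coeff d (dless a (f : MvPowerSeries ℕ k) +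
      MvPowerSeries.C (MvPowerSeries.constantCoeff a *
        MvPowerSeries.constantCoeff (f : MvPowerSeries ℕ k))) := by
  classical
  rw [coeff_sum_bel_mul_perp, sum_antidiagonal_triple d (fun p q r =>
    MvPowerSeries.coeff q a * pairing k (if ∀ i ∈ p.support, ∀ j ∈ q.support, i ≤ j then
      ribbonSum k N (pack p) * H k (pack r) else 0) f)]
  have hdless : MvPowerSeries.coeff d (dless a (f : MvPowerSeries ℕ k)) =
      ∑ u ∈ Finset.HasAntidiagonal.antidiagonal d, if u.1.support.min < u.2.support.min then
        MvPowerSeries.coeff u.1 a * MvPowerSeries.coeff u.2 (f : MvPowerSeries ℕ k) else 0 := by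
    change (∑ p ∈ _, _) = _
    exact Finset.sum_congr rfl fun p _ => by congr
  have hC : MvPowerSeries.coeff d (MvPowerSeries.C (MvPowerSeries.constantCoeff a *
      MvPowerSeries.constantCoeff (f : MvPowerSeries ℕ k))) =
      ∑ u ∈ Finset.HasAntidiagonal.antidiagonal d, if u.1 = 0 ∧ u.2 = 0 then
        MvPowerSeries.coeff u.1 a * MvPowerSeries.coeff u.2 (f : MvPowerSeries ℕ k) else 0 := by
    rw [MvPowerSeries.coeff_C]
    split_ifs with h
    · subst h
      simp
    · refine (Finset.sum_eq_zero fun u hu => if_neg fun h0 => h ?_).symm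
      rw [← Finset.HasAntidiagonal.mem_antidiagonal.1 hu, h0.1, h0.2, add_zero]
  rw [map_add, hdless, hC, ← Finset.sum_add_distrib]
  refine Finset.sum_congr rfl fun u hu => ?_
  have hu' := Finset.HasAntidiagonal.mem_antidiagonal.1 hu
  have hdeg : u.2.degree ≤ N := by
    rw [← hu', map_add] at hd
    omega
  have key := sum_ribbonSum_mul_H_pack (k := k) (N := N) (fun i => ∀ j ∈ u.1.support, i ≤ j)
    (fun i j hij hj l hl => hij.trans (hj l hl)) u.2 hdeg
  have key' := congrArg (fun g => MvPowerSeries.coeff u.1 a * pairing k g f) key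
  simp only [map_sum, LinearMap.sum_apply, Finset.mul_sum] at key'
  refine ((Finset.sum_congr rfl fun _ _ => by congr).trans key').trans ?_
  simp only [min_lt_min_iff]
  -- For `u.1 = 0` the initial segment is all of `ℕ`, so only `u.2 = 0` survives. This is the single
  -- pair counted by the constant term and not by `≺`.
  by_cases h1 : u.1 = 0
  · by_cases h2 : u.2 = 0
    · simp [h1, h2, pairing_H_pack, -pack_zero]
    · obtain ⟨i, hi⟩ := Finsupp.support_nonempty_iff.2 h2
      rw [if_neg (fun h => h i hi (by simp [h1])), if_neg (fun h => by simp [h1] at h),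
        if_neg (fun h => h2 h.2)]
      simp
  · have : u.1.support.Nonempty := Finsupp.support_nonempty_iff.2 h1
    simp only [this, h1, true_and, false_and, if_false, add_zero, not_forall, not_le]
    split_ifs with h3 h4 h4
    · rw [pairing_H_pack]
    · exact absurd (fun i hi => by simpa using h3 i hi) h4
    · exact absurd (fun i hi => by simpa using h4 i hi) h3
    · simp

/-! ### Finiteness -/

theorem pairing_H_eq_zero {f : QSym k} {N : ℕ}
    (hN : ∀ m : ℕ →₀ ℕ, N < m.degree → MvPowerSeries.coeff m (f : MvPowerSeries ℕ k) = 0)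
    {α : Comp} (hα : N < size α) : pairing k (H k α) f = 0 := by
  rw [pairing_H]
  exact hN _ (by rwa [degree_monoAt])

/-- `R_α` is homogeneous of degree `|α|`, so left multiplication by it lands in degrees at least
`|α|`, where `f` has no terms. -/
theorem perp_R_eq_zero {f : QSym k} {N : ℕ}
    (hN : ∀ m : ℕ →₀ ℕ, N < m.degree → MvPowerSeries.coeff m (f : MvPowerSeries ℕ k) = 0)
    {α : Comp} (hα : N < size α) : perp (R k α) f = 0 := by
  apply qsym_ext
  intro g
  rw [map_zero, pairing_perp]
  have h : (pairing k).flip f ∘ₗ LinearMap.mulLeft k (R k α) = 0 := by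
    apply nsym_linear_ext
    intro δ
    change pairing k (R k α * H k δ) f = 0
    rw [R, Finset.sum_mul, map_sum, LinearMap.sum_apply]
    refine Finset.sum_eq_zero fun S _ => ?_
    rw [smul_mul_assoc, H_mul_H, map_smul, LinearMap.smul_apply, pairing_H_eq_zero hN, smul_zero]
    rw [size_append, size_ofPartialSums]
    omega
  exact LinearMap.congr_fun h g

end QuasiSymm

/-! ### The identity for the full sum -/

theorem mainTheorem8 (k : Type*) [CommRing k] (a f : QuasiSymm.QSym k) :
    {α : QuasiSymm.Comp |
        QuasiSymm.perp (QuasiSymm.R k (QuasiSymm.omegaComp α)) f ≠ 0}.Finite ∧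
    (MvPowerSeries.constantCoeff (a : MvPowerSeries ℕ k) *
        MvPowerSeries.constantCoeff (f : MvPowerSeries ℕ k) = 0 →
      ∑ᶠ α : QuasiSymm.Comp, (-1 : k) ^ QuasiSymm.size α •
          (QuasiSymm.bel (QuasiSymm.F k α : MvPowerSeries ℕ k) (a : MvPowerSeries ℕ k) *
            (QuasiSymm.perp (QuasiSymm.R k (QuasiSymm.omegaComp α)) f : MvPowerSeries ℕ k)) =
        QuasiSymm.dless (a : MvPowerSeries ℕ k) (f : MvPowerSeries ℕ k)) ∧
    ∑ᶠ α : QuasiSymm.Comp, (-1 : k) ^ QuasiSymm.size α •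
        (QuasiSymm.bel (QuasiSymm.F k α : MvPowerSeries ℕ k) (a : MvPowerSeries ℕ k) *
          (QuasiSymm.perp (QuasiSymm.R k (QuasiSymm.omegaComp α)) f : MvPowerSeries ℕ k)) =
      QuasiSymm.dless (a : MvPowerSeries ℕ k) (f : MvPowerSeries ℕ k) +
        MvPowerSeries.C (MvPowerSeries.constantCoeff (a : MvPowerSeries ℕ k) *
          MvPowerSeries.constantCoeff (f : MvPowerSeries ℕ k)) := by
  obtain ⟨B, hB⟩ := f.2.1
  have hzero : ∀ α, B < QuasiSymm.size α →
      QuasiSymm.perp (QuasiSymm.R k (QuasiSymm.omegaComp α)) f = 0 := fun α hα =>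
    QuasiSymm.perp_R_eq_zero hB (by rwa [QuasiSymm.size_omegaComp])
  have hgeneral : ∑ᶠ α : QuasiSymm.Comp, (-1 : k) ^ QuasiSymm.size α •
        (QuasiSymm.bel (QuasiSymm.F k α : MvPowerSeries ℕ k) (a : MvPowerSeries ℕ k) *
          (QuasiSymm.perp (QuasiSymm.R k (QuasiSymm.omegaComp α)) f : MvPowerSeries ℕ k)) =
      QuasiSymm.dless (a : MvPowerSeries ℕ k) (f : MvPowerSeries ℕ k) +
        MvPowerSeries.C (MvPowerSeries.constantCoeff (a : MvPowerSeries ℕ k) *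
          MvPowerSeries.constantCoeff (f : MvPowerSeries ℕ k)) := by
    ext d
    -- The cutoff may depend on `d`: size `B` captures all nonzero summands, and `d.degree` is what
    -- the comparison of coefficients at `d` requires.
    rw [finsum_eq_sum_of_support_subset (s := QuasiSymm.compsLE (max B d.degree)),
      QuasiSymm.sum_bel_mul_perp_coeff _ _ (le_max_right _ _)]
    intro α hα
    rw [Finset.mem_coe, QuasiSymm.mem_compsLE]
    by_contra h
    refine hα ?_
    dsimp only
    rw [hzero α (by omega), ZeroMemClass.coe_zero, mul_zero, smul_zero]
  refine ⟨(QuasiSymm.finite_size_le B).subset fun α hα => ?_, fun h => ?_, hgeneral⟩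
  · by_contra h
    exact hα (hzero α (not_le.1 h))
  · rw [hgeneral, h, map_zero, add_zero]
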